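/- Let $\Omega\subset\mathbb{R}^N$ be a bounded convex domain (open set), let $\varepsilon>0$, and let $\mu$ be a Borel probability measure on $\Omega\times\{0,1\}$ such that the class-conditional distributions $\varrho_i:=\mu(\,\cdot\,\times\{i\})$, $i\in\{0,1\}$, are absolutely continuous with respect to the Lebesgue measure; denote their densities again by $\varrho_0,\varrho_1$. Write $B_\varepsilon(x)$ for the open Euclidean ball, $\overline{B_\varepsilon(x)}$ for its closure, and for $u\in L^\infty(\Omega)$ put $$\operatorname{TV}_\varepsilon(u):=\int_\Omega\frac{\operatorname{ess\,sup}_{B_\varepsilon(x)\cap\Omega}u-u(x)}{\varepsilon}\,\varrho_0(x)\,dx+\int_\Omega\frac{u(x)-\operatorname{ess\,inf}_{B_\varepsilon(x)\cap\Omega}u}{\varepsilon}\,\varrho_1(x)\,dx,$$ with essential suprema and infima taken with respect to the Lebesgue measure. Let $\mathfrak{P}$ be the set of all $\Psi\in L^1(\Omega\times\Omega)$ with $\Psi\ge 0$ a.e. on $\Omega\times\Omega$ and, for a.e. $x\in\Omega$, $\int_\Omega\Psi(x,y)\,dy=1$ and $\operatorname{ess\,supp}\Psi(x,\cdot)\subset\overline{B_\varepsilon(x)}\cap\overline\Omega$.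 For $\boldsymbol\Psi=(\Psi_0,\Psi_1)\in\mathfrak{P}\times\mathfrak{P}$ and $x,y\in\Omega$ define $$[\boldsymbol\Psi;\boldsymbol\varrho](x,y):=\Psi_0(x,y)\varrho_0(x)-\Psi_1(x,y)\varrho_1(x),\qquad \nabla_\varepsilon[u](x,y):=\frac{u(y)-u(x)}{\varepsilon},$$ and, for $f\in L^1(\Omega\times\Omega)$, $$\operatorname{div}_\varepsilon[f](y):=\int_{B_\varepsilon(y)\cap\Omega}\frac{f(y,x)-f(x,y)}{\varepsilon}\,dx .$$ Then for every $u\in L^\infty(\Omega)$ both integrals defining $\operatorname{TV}_\varepsilon(u)$ are finite; for every $\boldsymbol\Psi\in\mathfrak{P}\times\mathfrak{P}$ the functions $[\boldsymbol\Psi;\boldsymbol\varrho]$ and $\nabla_\varepsilon[u]\,[\boldsymbol\Psi;\boldsymbol\varrho]$ belong to $L^1(\Omega\times\Omega)$, and $\operatorname{div}_\varepsilon[\boldsymbol\Psi;\boldsymbol\varrho]:=\operatorname{div}_\varepsilon\big[[\boldsymbol\Psi;\boldsymbol\varrho]\big]$ and $u\operatorname{div}_\varepsilon[\boldsymbol\Psi;\boldsymbol\varrho]$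 belong to $L^1(\Omega)$; and $$\operatorname{TV}_\varepsilon(u)=\sup_{\boldsymbol\Psi\in\mathfrak{P}\times\mathfrak{P}}\int_\Omega\int_\Omega\nabla_\varepsilon[u](x,y)\,[\boldsymbol\Psi;\boldsymbol\varrho](x,y)\,dy\,dx=\sup_{\boldsymbol\Psi\in\mathfrak{P}\times\mathfrak{P}}-\int_\Omega u(y)\operatorname{div}_\varepsilon[\boldsymbol\Psi;\boldsymbol\varrho](y)\,dy .$$ -/

import Mathlib

open MeasureTheory Set Metric
open scoped ENNReal Topology

-- Subsets carry the restricted measure: for `Ω` open, `volume` on the subtype `Ω` is Lebesgue measure.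
attribute [local instance] MeasureTheory.Measure.Subtype.measureSpace

noncomputable section

namespace AdversarialTV

/-- The class-conditional distribution `A ↦ μ (A × {i})` of a measure `μ` on `Ω × {0,1}`. -/
def classMeasure {X : Type*} [MeasurableSpace X] (μ : Measure (X × Fin 2)) (i : Fin 2) :
    Measure X :=
  (μ.restrict (univ ×ˢ {i})).map Prod.fst

variable {N : ℕ} {Ω : Set (EuclideanSpace ℝ (Fin N))}

/-- The Lebesgue density of the `i`-th class-conditional distribution. The measure `volume` on the
subtype `Ω` is the restriction of the `N`-dimensional Lebesgue measure to `Ω`. -/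
def density (μ : Measure (Ω × Fin 2)) (i : Fin 2) (x : Ω) : ℝ :=
  ((classMeasure μ i).rnDeriv volume x).toReal

/-- The essential support, as a (closed) subset of `ℝᴺ`, of a function on `Ω`: the points that
have no neighbourhood on which the function vanishes almost everywhere. -/
def essSupport (φ : Ω → ℝ) : Set (EuclideanSpace ℝ (Fin N)) :=
  {z | ∀ U ∈ 𝓝 z, ¬ ∀ᵐ y : Ω, (y : EuclideanSpace ℝ (Fin N)) ∈ U → φ y = 0}

/-- The test functions: transition densities in `L¹(Ω × Ω)` whose essential support in the second
variable lies in the closed `ε`-ball around the first one. Since elements of `L¹` are classes of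
functions, conditions on the slices `Ψ (x, ·)` are required for almost every `x`. -/
def testDensities (Ω : Set (EuclideanSpace ℝ (Fin N))) (ε : ℝ) :
    Set (Lp ℝ 1 (volume : Measure (Ω × Ω))) :=
  {Ψ | (∀ᵐ p : Ω × Ω, 0 ≤ Ψ p) ∧
    (∀ᵐ x : Ω, ∫ y : Ω, Ψ (x, y) = 1) ∧
    ∀ᵐ x : Ω, essSupport (fun y : Ω => Ψ (x, y)) ⊆
      closedBall (x : EuclideanSpace ℝ (Fin N)) ε ∩ closure Ω}

/-- The nonlocal gradient `(x, y) ↦ (u y - u x) / ε`. -/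
def nonlocalGrad (ε : ℝ) (u : Ω → ℝ) (p : Ω × Ω) : ℝ :=
  (u p.2 - u p.1) / ε

/-- The nonlocal divergence; `ball y ε` is the ball of the metric space `Ω`, i.e. the Euclidean
ball intersected with `Ω`. -/
def nonlocalDiv (ε : ℝ) (f : Ω × Ω → ℝ) (y : Ω) : ℝ :=
  ∫ x in ball y ε, (f (y, x) - f (x, y)) / ε

/-- The antisymmetric pairing `[Ψ; ρ] (x, y) = Ψ₀ (x, y) ρ₀ x - Ψ₁ (x, y) ρ₁ x`. -/
def pairing (Ψ₀ Ψ₁ : Ω × Ω → ℝ) (ρ₀ ρ₁ : Ω → ℝ) (p : Ω × Ω) : ℝ :=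
  Ψ₀ p * ρ₀ p.1 - Ψ₁ p * ρ₁ p.1

/-- The integrand of the first term of the adversarial total variation. -/
def upperIntegrand (ε : ℝ) (ρ₀ u : Ω → ℝ) (x : Ω) : ℝ :=
  (essSup u (volume.restrict (ball x ε)) - u x) / ε * ρ₀ x

/-- The integrand of the second term of the adversarial total variation. -/
def lowerIntegrand (ε : ℝ) (ρ₁ u : Ω → ℝ) (x : Ω) : ℝ :=
  (u x - essInf u (volume.restrict (ball x ε))) / ε * ρ₁ x

/-- The adversarial total variation. -/
def adversarialTV (ε : ℝ) (ρ₀ ρ₁ u : Ω → ℝ) : ℝ :=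
  (∫ x : Ω, upperIntegrand ε ρ₀ u x) + ∫ x : Ω, lowerIntegrand ε ρ₁ u x

end AdversarialTV

end

/-!
Averaging `u` against a transition density `Ψ (x, ·)` concentrated on the `ε`-ball around `x` gives
at most the essential supremum of `u` over that ball. The supremum is approached by the density
that is uniform on the set of points of the ball where `u` exceeds its essential supremum minus `δ`,
a set of positive measure. Since the essential infimum of `u` is minus the essential supremum of
`-u`, the two terms of the total variation are suprema of the same kind over independent variables,
so they add up to the first representation. The second one follows from the first by Fubini's
theorem and exchanging the two variables.
-/

namespace AdversarialTV

section EssSup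

variable {X : Type*} [MeasurableSpace X] {ν : Measure X} {u : X → ℝ} {C : ℝ}

theorem essSup_le_iff_of_ae_abs_le [NeZero ν] (hu : ∀ᵐ x ∂ν, |u x| ≤ C) {c : ℝ} :
    essSup u ν ≤ c ↔ ∀ᵐ x ∂ν, u x ≤ c := by
  have : (ae ν).NeBot := ae_neBot.2 (NeZero.ne ν)
  have hbelow : (ae ν).IsBoundedUnder (· ≥ ·) u :=
    Filter.isBoundedUnder_of_eventually_ge (hu.mono fun _ hx => (abs_le.1 hx).1)
  have habove : (ae ν).IsBoundedUnder (· ≤ ·) u :=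
    Filter.isBoundedUnder_of_eventually_le (hu.mono fun _ hx => (abs_le.1 hx).2)
  exact ⟨fun h => (ae_le_essSup habove).mono fun _ hx => hx.trans h,
    fun h => Filter.limsup_le_of_le hbelow.isCoboundedUnder_le h⟩

theorem abs_essSup_le_of_ae_abs_le [NeZero ν] (hu : ∀ᵐ x ∂ν, |u x| ≤ C) : |essSup u ν| ≤ C := by
  have : (ae ν).NeBot := ae_neBot.2 (NeZero.ne ν)
  refine abs_le.2 ⟨?_, (essSup_le_iff_of_ae_abs_le hu).2 (hu.mono fun _ hx => (abs_le.1 hx).2)⟩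
  obtain ⟨x, hx, hxS⟩ := (hu.and ((essSup_le_iff_of_ae_abs_le hu).1 le_rfl)).exists
  exact (abs_le.1 hx).1.trans hxS

theorem essInf_eq_neg_essSup_neg (u : X → ℝ) (ν : Measure X) :
    essInf u ν = -essSup (-u) ν := by
  rw [essInf_eq_sSup, essSup_eq_sInf, ← Real.sSup_neg]
  congr 1
  ext a
  simp

end EssSup

section Bounded

variable {X Y : Type*} [MeasurableSpace X] [MeasurableSpace Y] {μ : Measure Y} {ν : Measure X}

theorem memLp_top_comp_quasiMeasurePreserving {u : X → ℝ} (hu : MemLp u ∞ ν) {g : Y → X}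
    (hg : Measure.QuasiMeasurePreserving g μ ν) : MemLp (u ∘ g) ∞ μ :=
  memLp_top_of_bound (hu.1.comp_quasiMeasurePreserving hg) _
    (hg.ae (ae_le_lpNorm_exponent_top hu))

variable {u v w ρ : X → ℝ} {ε : ℝ}

theorem integrable_sub_div_mul (hv : MemLp v ∞ ν) (hu : MemLp u ∞ ν) (hρ : Integrable ρ ν) :
    Integrable (fun x => (v x - u x) / ε * ρ x) ν := by
  simp_rw [div_eq_mul_inv]
  exact hρ.mul_of_top_right ((hv.sub hu).mul_const ε⁻¹)

theorem integral_sub_div_mul_mono (hε : 0 ≤ ε) (hρ0 : 0 ≤ᵐ[ν] ρ) (hρ : Integrable ρ ν)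
    (hu : MemLp u ∞ ν) (hv : MemLp v ∞ ν) (hw : MemLp w ∞ ν) (hvw : v ≤ᵐ[ν] w) :
    ∫ x, (v x - u x) / ε * ρ x ∂ν ≤ ∫ x, (w x - u x) / ε * ρ x ∂ν := by
  refine integral_mono_ae (integrable_sub_div_mul hv hu hρ) (integrable_sub_div_mul hw hu hρ) ?_
  filter_upwards [hρ0, hvw] with x hρx hx
  have : 0 ≤ ρ x := hρx
  gcongr

theorem integral_mul_le_of_integral_eq_one {φ : X → ℝ} {c : ℝ} (hφ0 : 0 ≤ᵐ[ν] φ)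
    (hφ1 : ∫ y, φ y ∂ν = 1) (hφu : Integrable (fun y => φ y * u y) ν)
    (hc : ∀ᵐ y ∂ν, φ y ≠ 0 → u y ≤ c) : ∫ y, φ y * u y ∂ν ≤ c := by
  have hφ := integrable_of_integral_eq_one hφ1
  calc ∫ y, φ y * u y ∂ν ≤ ∫ y, φ y * c ∂ν := by
        refine integral_mono_ae hφu (hφ.mul_const c) ?_
        filter_upwards [hφ0, hc] with y hy0 hyc
        rcases eq_or_ne (φ y) 0 with hy | hy
        · simp only [hy, zero_mul, le_refl]
        · exact mul_le_mul_of_nonneg_left (hyc hy) hy0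
    _ = c := by rw [integral_mul_const, hφ1, one_mul]

theorem integral_mul_sub_const_of_integral_eq_one {φ : X → ℝ} (hφ1 : ∫ y, φ y ∂ν = 1)
    (hφu : Integrable (fun y => φ y * u y) ν) (c : ℝ) :
    ∫ y, φ y * (u y - c) ∂ν = (∫ y, φ y * u y ∂ν) - c := by
  have hφ := integrable_of_integral_eq_one hφ1
  simp only [mul_sub]
  rw [integral_sub hφu (hφ.mul_const c), integral_mul_const, hφ1, one_mul]

end Bounded

section Ball

variable {X : Type*} [PseudoMetricSpace X] [MeasurableSpace X] {ν : Measure X} {u : X → ℝ}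
  {ε C : ℝ}

theorem ae_restrict_ball_iff_forall_lt {p : X → Prop} {x : X} :
    (∀ᵐ y ∂ν.restrict (ball x ε), p y) ↔ ∀ r < ε, ∀ᵐ y ∂ν.restrict (ball x r), p y := by
  refine ⟨fun h r hr => ae_restrict_of_ae_restrict_of_subset (ball_subset_ball hr.le) h,
    fun h => ?_⟩
  obtain ⟨r, -, hr, hlim⟩ := exists_seq_strictMono_tendsto ε
  have hsub : ball x ε ⊆ ⋃ n, ball x (r n) := fun y hy =>
    mem_iUnion.2 (hlim.eventually (lt_mem_nhds (mem_ball.1 hy))).exists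
  exact ae_restrict_of_ae_restrict_of_subset hsub
    ((ae_restrict_iUnion_iff _ _).2 fun n => h (r n) (hr n))

variable [ν.IsOpenPosMeasure]

theorem neZero_restrict_ball (hε : 0 < ε) (x : X) : NeZero (ν.restrict (ball x ε)) :=
  ⟨fun h => (measure_ball_pos ν x hε).ne' (Measure.restrict_eq_zero.1 h)⟩

theorem lowerSemicontinuous_essSup_ball (hε : 0 < ε) (hu : ∀ᵐ x ∂ν, |u x| ≤ C) :
    LowerSemicontinuous fun x => essSup u (ν.restrict (ball x ε)) := by
  have lt_essSup_iff (x : X) (c : ℝ) : c < essSup u (ν.restrict (ball x ε)) ↔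
      ¬ ∀ᵐ y ∂ν.restrict (ball x ε), u y ≤ c := by
    have := neZero_restrict_ball (ν := ν) hε x
    rw [← not_le, essSup_le_iff_of_ae_abs_le (ae_restrict_of_ae hu)]
  intro x c hc
  simp only [lt_essSup_iff] at hc ⊢
  rw [ae_restrict_ball_iff_forall_lt] at hc
  simp only [not_forall] at hc
  obtain ⟨r, hr, hrc⟩ := hc
  filter_upwards [ball_mem_nhds x (sub_pos.2 hr)] with z hz
  have hsub : ball x r ⊆ ball z ε := ball_subset_ball' (by linarith [mem_ball'.1 hz])
  exact fun h => hrc (ae_restrict_of_ae_restrict_of_subset hsub h)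

theorem memLp_top_essSup_ball [OpensMeasurableSpace X] (hε : 0 < ε) (hu : MemLp u ∞ ν) :
    MemLp (fun x => essSup u (ν.restrict (ball x ε))) ∞ ν := by
  have hbound := ae_le_lpNorm_exponent_top hu
  refine memLp_top_of_bound
    (lowerSemicontinuous_essSup_ball hε hbound).measurable.aestronglyMeasurable
    (lpNorm u ∞ ν) (ae_of_all _ fun x => ?_)
  have := neZero_restrict_ball (ν := ν) hε x
  exact abs_essSup_le_of_ae_abs_le (ae_restrict_of_ae hbound)

end Ball

section TransitionDensity

variable {X : Type*} [MeasurableSpace X] {ν : Measure X}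

/-- The mean of `u` after one jump from `x` distributed according to the density `Ψ (x, ·)`. -/
noncomputable def transitionMean (ν : Measure X) (Ψ : X × X → ℝ) (u : X → ℝ) (x : X) : ℝ :=
  ∫ y, Ψ (x, y) * u y ∂ν

theorem transitionMean_congr_ae [SFinite ν] {Φ Ψ : X × X → ℝ} (h : Φ =ᵐ[ν.prod ν] Ψ) (u : X → ℝ) :
    transitionMean ν Φ u =ᵐ[ν] transitionMean ν Ψ u := by
  filter_upwards [Measure.ae_ae_of_ae_prod h] with x hx
  exact integral_congr_ae (hx.mono fun y hy => congrArg (· * u y) hy)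

theorem transitionMean_neg (Ψ : X × X → ℝ) (u : X → ℝ) :
    transitionMean ν Ψ (-u) = -transitionMean ν Ψ u := by
  ext x
  simp only [transitionMean, Pi.neg_apply, mul_neg, integral_neg]

variable [PseudoMetricSpace X]

/-- The elements of the class `𝔓` of the paper, as functions on the square of an arbitrary metric
measure space: densities `Ψ (x, ·)` of random jumps from `x` of length less than `ε`. Every
condition is invariant under modification of `Ψ` on a null set. -/
structure IsTransitionDensity (ν : Measure X) (ε : ℝ) (Ψ : X × X → ℝ) : Prop where
  aestronglyMeasurable : AEStronglyMeasurable Ψ (ν.prod ν)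
  nonneg : 0 ≤ᵐ[ν.prod ν] Ψ
  integral_eq_one : ∀ᵐ x ∂ν, ∫ y, Ψ (x, y) ∂ν = 1
  eq_zero : ∀ᵐ p ∂ν.prod ν, ε ≤ dist p.1 p.2 → Ψ p = 0

namespace IsTransitionDensity

variable {ε : ℝ} {Φ Ψ : X × X → ℝ} {u ρ : X → ℝ}

theorem ae_integrable_mul (hΨ : IsTransitionDensity ν ε Ψ) (hu : MemLp u ∞ ν) :
    ∀ᵐ x ∂ν, Integrable (fun y => Ψ (x, y) * u y) ν := by
  filter_upwards [hΨ.integral_eq_one] with x hx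
  exact (integrable_of_integral_eq_one hx).mul_of_top_left hu

variable [SFinite ν]

theorem congr (hΨ : IsTransitionDensity ν ε Ψ) (h : Ψ =ᵐ[ν.prod ν] Φ) :
    IsTransitionDensity ν ε Φ where
  aestronglyMeasurable := hΨ.aestronglyMeasurable.congr h
  nonneg := hΨ.nonneg.trans_eq h
  integral_eq_one := by
    filter_upwards [hΨ.integral_eq_one, Measure.ae_ae_of_ae_prod h] with x hx hxΦ
    rw [← hx]
    exact integral_congr_ae (hxΦ.mono fun y hy => hy.symm)
  eq_zero := by
    filter_upwards [hΨ.eq_zero, h] with p hp hpΦ hd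
    rw [← hpΦ, hp hd]

theorem integrable_mul (hΨ : IsTransitionDensity ν ε Ψ) (hρ : Integrable ρ ν) :
    Integrable (fun p : X × X => Ψ p * ρ p.1) (ν.prod ν) := by
  have hmeas : AEStronglyMeasurable (fun p : X × X => Ψ p * ρ p.1) (ν.prod ν) :=
    hΨ.aestronglyMeasurable.mul hρ.aestronglyMeasurable.comp_fst
  refine (integrable_prod_iff hmeas).2 ⟨hΨ.integral_eq_one.mono fun x hx =>
    (integrable_of_integral_eq_one hx).mul_const (ρ x), hρ.norm.congr ?_⟩
  filter_upwards [hΨ.integral_eq_one, Measure.ae_ae_of_ae_prod hΨ.nonneg] with x hx hx0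
  calc ‖ρ x‖ = ∫ y, Ψ (x, y) * ‖ρ x‖ ∂ν := by rw [integral_mul_const, hx, one_mul]
    _ = ∫ y, ‖Ψ (x, y) * ρ x‖ ∂ν := integral_congr_ae <| hx0.mono fun y hy => by
        simp only [norm_mul, Real.norm_of_nonneg hy]

theorem memLp_top_transitionMean (hΨ : IsTransitionDensity ν ε Ψ) (hu : MemLp u ∞ ν) :
    MemLp (transitionMean ν Ψ u) ∞ ν := by
  refine memLp_top_of_bound
    (hΨ.aestronglyMeasurable.mul hu.aestronglyMeasurable.comp_snd).integral_prod_right'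
    (lpNorm u ∞ ν) ?_
  filter_upwards [hΨ.integral_eq_one, Measure.ae_ae_of_ae_prod hΨ.nonneg] with x hx hx0
  calc ‖transitionMean ν Ψ u x‖ ≤ ∫ y, ‖Ψ (x, y) * u y‖ ∂ν := norm_integral_le_integral_norm _
    _ = ∫ y, Ψ (x, y) * ‖u y‖ ∂ν := integral_congr_ae <| hx0.mono fun y hy => by
        simp only [norm_mul, Real.norm_of_nonneg hy]
    _ ≤ lpNorm u ∞ ν := integral_mul_le_of_integral_eq_one hx0 hx
        ((integrable_of_integral_eq_one hx).mul_of_top_left hu.norm)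
        ((ae_le_lpNorm_exponent_top hu).mono fun _ hy _ => hy)

theorem transitionMean_le_essSup_ball [OpensMeasurableSpace X] [ν.IsOpenPosMeasure]
    (hΨ : IsTransitionDensity ν ε Ψ) (hε : 0 < ε) (hu : MemLp u ∞ ν) :
    transitionMean ν Ψ u ≤ᵐ[ν] fun x => essSup u (ν.restrict (ball x ε)) := by
  filter_upwards [hΨ.integral_eq_one, Measure.ae_ae_of_ae_prod hΨ.nonneg,
    Measure.ae_ae_of_ae_prod hΨ.eq_zero, hΨ.ae_integrable_mul hu] with x hx hx0 hxz hxu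
  have := neZero_restrict_ball (ν := ν) hε x
  have hball : ∀ᵐ y ∂ν, y ∈ ball x ε → u y ≤ essSup u (ν.restrict (ball x ε)) :=
    (ae_restrict_iff' measurableSet_ball).1 <| (essSup_le_iff_of_ae_abs_le
      (ae_restrict_of_ae (ae_le_lpNorm_exponent_top hu))).1 le_rfl
  refine integral_mul_le_of_integral_eq_one hx0 hx hxu ?_
  filter_upwards [hxz, hball] with y hyz hy hΨy
  exact hy (mem_ball'.2 (not_le.1 fun hd => hΨy (hyz hd)))

end IsTransitionDensity

end TransitionDensity

section NearMaximizers

variable {X : Type*} [PseudoMetricSpace X] [MeasurableSpace X] {ν : Measure X} {u : X → ℝ}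
  {ε δ : ℝ}

/-- The points of the `ε`-ball around `x` at which `u` exceeds its essential supremum over that
ball minus `δ`. -/
def nearMaximizers (ν : Measure X) (ε δ : ℝ) (u : X → ℝ) (x : X) : Set X :=
  {y | dist x y < ε ∧ essSup u (ν.restrict (ball x ε)) - δ < u y}

/-- The transition density for which `Ψ (x, ·)` is uniform on the near-maximizers of `u` around
`x`. -/
noncomputable def nearMaximizerDensity (ν : Measure X) (ε δ : ℝ) (u : X → ℝ) (p : X × X) : ℝ :=
  (nearMaximizers ν ε δ u p.1).indicator (fun _ => (ν.real (nearMaximizers ν ε δ u p.1))⁻¹) p.2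

theorem nearMaximizerDensity_nonneg (p : X × X) : 0 ≤ nearMaximizerDensity ν ε δ u p :=
  indicator_nonneg (fun _ _ => inv_nonneg.2 measureReal_nonneg) _

variable [OpensMeasurableSpace X] [ν.IsOpenPosMeasure]

theorem measure_nearMaximizers_pos (hε : 0 < ε) (hδ : 0 < δ) (hu : MemLp u ∞ ν) (x : X) :
    0 < ν (nearMaximizers ν ε δ u x) := by
  have := neZero_restrict_ball (ν := ν) hε x
  refine pos_iff_ne_zero.2 fun h0 => (sub_lt_self (essSup u (ν.restrict (ball x ε))) hδ).not_ge
    ((essSup_le_iff_of_ae_abs_le (ae_restrict_of_ae (ae_le_lpNorm_exponent_top hu))).2 ?_)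
  rw [ae_restrict_iff' measurableSet_ball]
  filter_upwards [measure_eq_zero_iff_ae_notMem.1 h0] with y hy hyx
  exact not_lt.1 fun hlt => hy ⟨mem_ball'.1 hyx, hlt⟩

variable [SecondCountableTopology X]

theorem measurableSet_nearMaximizers (hε : 0 < ε) (hum : Measurable u) (hu : MemLp u ∞ ν) :
    MeasurableSet {p : X × X | p.2 ∈ nearMaximizers ν ε δ u p.1} :=
  have hess := (lowerSemicontinuous_essSup_ball hε (ae_le_lpNorm_exponent_top hu)).measurable
  (measurableSet_lt (measurable_fst.dist measurable_snd) measurable_const).inter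
    (measurableSet_lt ((hess.comp measurable_fst).sub_const δ) (hum.comp measurable_snd))

theorem measurable_nearMaximizerDensity [SFinite ν] (hε : 0 < ε) (hum : Measurable u)
    (hu : MemLp u ∞ ν) : Measurable (nearMaximizerDensity ν ε δ u) := by
  have hset := measurableSet_nearMaximizers (δ := δ) hε hum hu
  exact ((measurable_measure_prodMk_left hset).ennreal_toReal.inv.comp measurable_fst).indicator
    hset

variable [IsFiniteMeasure ν]

theorem integral_nearMaximizerDensity (hε : 0 < ε) (hδ : 0 < δ) (hum : Measurable u)
    (hu : MemLp u ∞ ν) (x : X) : ∫ y, nearMaximizerDensity ν ε δ u (x, y) ∂ν = 1 := by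
  have hmeas : MeasurableSet (nearMaximizers ν ε δ u x) :=
    measurable_prodMk_left (measurableSet_nearMaximizers hε hum hu)
  have hpos : 0 < ν.real (nearMaximizers ν ε δ u x) :=
    ENNReal.toReal_pos (measure_nearMaximizers_pos hε hδ hu x).ne' (measure_ne_top _ _)
  simp only [nearMaximizerDensity]
  rw [integral_indicator_const _ hmeas, smul_eq_mul, mul_inv_cancel₀ hpos.ne']

theorem isTransitionDensity_nearMaximizerDensity (hε : 0 < ε) (hδ : 0 < δ) (hum : Measurable u)
    (hu : MemLp u ∞ ν) : IsTransitionDensity ν ε (nearMaximizerDensity ν ε δ u) where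
  aestronglyMeasurable := (measurable_nearMaximizerDensity hε hum hu).aestronglyMeasurable
  nonneg := ae_of_all _ nearMaximizerDensity_nonneg
  integral_eq_one := ae_of_all _ (integral_nearMaximizerDensity hε hδ hum hu)
  eq_zero := ae_of_all _ fun _ hp => indicator_of_notMem (fun h => hp.not_gt h.1) _

theorem essSup_ball_sub_le_transitionMean_nearMaximizerDensity (hε : 0 < ε) (hδ : 0 < δ)
    (hum : Measurable u) (hu : MemLp u ∞ ν) (x : X) :
    essSup u (ν.restrict (ball x ε)) - δ ≤
      transitionMean ν (nearMaximizerDensity ν ε δ u) u x := by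
  have hone := integral_nearMaximizerDensity hε hδ hum hu x
  have hle := integral_mul_le_of_integral_eq_one (u := -u)
    (c := -(essSup u (ν.restrict (ball x ε)) - δ))
    (ae_of_all _ fun y => nearMaximizerDensity_nonneg (x, y)) hone
    ((integrable_of_integral_eq_one hone).mul_of_top_left hu.neg)
    (ae_of_all _ fun y hy => neg_le_neg (mem_of_indicator_ne_zero hy).2.le)
  change transitionMean ν _ (-u) x ≤ _ at hle
  rwa [transitionMean_neg, Pi.neg_apply, neg_le_neg_iff] at hle

theorem isLUB_integral_transitionMean_sub (hε : 0 < ε) (hum : Measurable u) (hu : MemLp u ∞ ν)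
    {ρ : X → ℝ} (hρ : Integrable ρ ν) (hρ0 : 0 ≤ᵐ[ν] ρ) :
    IsLUB ((fun Ψ => ∫ x, (transitionMean ν Ψ u x - u x) / ε * ρ x ∂ν) ''
        {Ψ | IsTransitionDensity ν ε Ψ})
      (∫ x, (essSup u (ν.restrict (ball x ε)) - u x) / ε * ρ x ∂ν) := by
  have hess := memLp_top_essSup_ball hε hu
  constructor
  · rintro _ ⟨Ψ, hΨ : IsTransitionDensity ν ε Ψ, rfl⟩
    exact integral_sub_div_mul_mono hε.le hρ0 hρ hu (hΨ.memLp_top_transitionMean hu) hess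
      (hΨ.transitionMean_le_essSup_ball hε hu)
  · intro b hb
    set T := ∫ x, (essSup u (ν.restrict (ball x ε)) - u x) / ε * ρ x ∂ν
    have hT (δ : ℝ) (hδ : 0 < δ) : T - δ / ε * ∫ x, ρ x ∂ν ≤ b := by
      have hΨ := isTransitionDensity_nearMaximizerDensity hε hδ hum hu
      calc T - δ / ε * ∫ x, ρ x ∂ν
          = ∫ x, (essSup u (ν.restrict (ball x ε)) - δ - u x) / ε * ρ x ∂ν := by
            rw [← integral_const_mul,
              ← integral_sub (integrable_sub_div_mul hess hu hρ) (hρ.const_mul _)]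
            exact integral_congr_ae (ae_of_all _ fun x => by ring)
        _ ≤ ∫ x, (transitionMean ν (nearMaximizerDensity ν ε δ u) u x - u x) / ε * ρ x ∂ν :=
            integral_sub_div_mul_mono hε.le hρ0 hρ hu (hess.sub (memLp_const δ))
              (hΨ.memLp_top_transitionMean hu) (ae_of_all _
                (essSup_ball_sub_le_transitionMean_nearMaximizerDensity hε hδ hum hu))
        _ ≤ b := hb ⟨_, hΨ, rfl⟩
    have hlim : Filter.Tendsto (fun δ => T - δ / ε * ∫ x, ρ x ∂ν) (𝓝[>] 0) (𝓝 T) :=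
      ((by fun_prop : Continuous fun δ => T - δ / ε * ∫ x, ρ x ∂ν).tendsto' 0 T
        (by simp)).mono_left nhdsWithin_le_nhds
    exact le_of_tendsto hlim (eventually_mem_nhdsWithin.mono hT)

end NearMaximizers

section IntegrationByParts

variable {X : Type*} [MeasurableSpace X] {ν : Measure X} [SFinite ν] {u : X → ℝ}
  {f : X × X → ℝ}

theorem integral_sub_mul_eq_neg_integral_mul_integral_sub (hu : MemLp u ∞ ν)
    (hf : Integrable f (ν.prod ν)) :
    ∫ x, ∫ y, (u y - u x) * f (x, y) ∂ν ∂ν =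
      -∫ y, u y * ∫ x, (f (y, x) - f (x, y)) ∂ν ∂ν := by
  have hfst : Integrable (fun p : X × X => u p.1 * f p) (ν.prod ν) := hf.mul_of_top_right
    (memLp_top_comp_quasiMeasurePreserving hu Measure.quasiMeasurePreserving_fst)
  have hsnd : Integrable (fun p : X × X => u p.2 * f p) (ν.prod ν) := hf.mul_of_top_right
    (memLp_top_comp_quasiMeasurePreserving hu Measure.quasiMeasurePreserving_snd)
  have hfst' : Integrable (fun p : X × X => u p.1 * f p.swap) (ν.prod ν) := hsnd.swap
  have hswap : ∫ p : X × X, u p.1 * f p.swap ∂ν.prod ν = ∫ p : X × X, u p.2 * f p ∂ν.prod ν :=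
    integral_prod_swap fun p : X × X => u p.2 * f p
  calc ∫ x, ∫ y, (u y - u x) * f (x, y) ∂ν ∂ν
      = ∫ p, (u p.2 * f p - u p.1 * f p) ∂ν.prod ν := by
        simp only [integral_prod _ (hsnd.sub' hfst), sub_mul]
    _ = -∫ p, (u p.1 * f p - u p.1 * f p.swap) ∂ν.prod ν := by
        rw [integral_sub hsnd hfst, integral_sub hfst hfst', hswap, neg_sub]
    _ = -∫ y, u y * ∫ x, (f (y, x) - f (x, y)) ∂ν ∂ν := by
        simp only [integral_prod _ (hfst.sub' hfst'), ← integral_const_mul, mul_sub,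
          Prod.swap_prod_mk]

end IntegrationByParts

section ClosedBallSupport

variable {X : Type*} [PseudoMetricSpace X] [SecondCountableTopology X] [MeasurableSpace X]
  [OpensMeasurableSpace X] {ν : Measure X} [SFinite ν] {ε : ℝ} {f : X × X → ℝ}

theorem ae_prod_eq_zero_of_le_dist_iff (hsphere : ∀ x, ν (sphere x ε) = 0) (hf : Measurable f) :
    (∀ᵐ p ∂ν.prod ν, ε ≤ dist p.1 p.2 → f p = 0) ↔
      ∀ᵐ x ∂ν, ∀ᵐ y ∂ν, ε < dist x y → f (x, y) = 0 := by
  have hmeas : MeasurableSet {p : X × X | ε ≤ dist p.1 p.2 → f p = 0} :=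
    (measurableSet_le measurable_const (measurable_fst.dist measurable_snd)).imp
      (hf (measurableSet_singleton 0))
  rw [Measure.ae_prod_iff_ae_ae hmeas]
  refine Filter.eventually_congr (ae_of_all _ fun x => Filter.eventually_congr ?_)
  filter_upwards [measure_eq_zero_iff_ae_notMem.1 (hsphere x)] with y hy
  rw [mem_sphere'] at hy
  exact ⟨fun h hlt => h hlt.le, fun h hle => h (hle.lt_of_ne' hy)⟩

end ClosedBallSupport

section Domain

variable {N : ℕ} {Ω : Set (EuclideanSpace ℝ (Fin N))} {ε : ℝ}

theorem isFiniteMeasure_volume_subtype (hΩ : MeasurableSet Ω) (hfin : volume Ω ≠ ∞) :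
    IsFiniteMeasure (volume : Measure Ω) :=
  ⟨(Measure.Subtype.volume_univ hΩ.nullMeasurableSet).trans_lt hfin.lt_top⟩

theorem isOpenPosMeasure_volume_subtype (hΩo : IsOpen Ω) :
    (volume : Measure Ω).IsOpenPosMeasure :=
  Measure.IsOpenPosMeasure.comap volume hΩo.isOpenEmbedding_subtypeVal

theorem volume_sphere_subtype (hΩ : MeasurableSet Ω) (hε : ε ≠ 0) (x : Ω) :
    volume (sphere x ε) = 0 := by
  rw [Measure.Subtype.volume_def, (MeasurableEmbedding.subtype_coe hΩ).comap_apply]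
  exact measure_mono_null (image_subset_iff.2 fun _ => id)
    (Measure.addHaar_sphere_of_ne_zero volume (x : EuclideanSpace ℝ (Fin N)) hε)

theorem essSupport_subset_iff_of_isClosed {φ : Ω → ℝ} {C : Set (EuclideanSpace ℝ (Fin N))}
    (hC : IsClosed C) :
    essSupport φ ⊆ C ↔ ∀ᵐ y : Ω, (y : EuclideanSpace ℝ (Fin N)) ∉ C → φ y = 0 := by
  refine ⟨fun h => ?_, fun h z hz => ?_⟩
  · refine ae_iff.2 (measure_null_of_locally_null _ fun y hy => ?_)
    have hyC : (y : EuclideanSpace ℝ (Fin N)) ∉ C := (Classical.not_imp.1 hy).1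
    obtain ⟨U, hU, hUφ⟩ : ∃ U ∈ 𝓝 (y : EuclideanSpace ℝ (Fin N)),
        ∀ᵐ z : Ω, (z : EuclideanSpace ℝ (Fin N)) ∈ U → φ z = 0 := by
      by_contra hU
      exact hyC (h fun U hU' hUφ => hU ⟨U, hU', hUφ⟩)
    refine ⟨Subtype.val ⁻¹' U ∩ {z | ¬((z : EuclideanSpace ℝ (Fin N)) ∉ C → φ z = 0)},
      Filter.inter_mem (mem_nhdsWithin_of_mem_nhds (continuous_subtype_val.continuousAt hU))
        self_mem_nhdsWithin, measure_mono_null ?_ (ae_iff.1 hUφ)⟩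
    exact fun z hz hzφ => (Classical.not_imp.1 hz.2).2 (hzφ hz.1)
  · by_contra hzC
    exact hz Cᶜ (hC.isOpen_compl.mem_nhds hzC) h

theorem essSupport_subset_closedBall_inter_closure_iff {φ : Ω → ℝ} {x : Ω} :
    essSupport φ ⊆ closedBall (x : EuclideanSpace ℝ (Fin N)) ε ∩ closure Ω ↔
      ∀ᵐ y : Ω, ε < dist x y → φ y = 0 := by
  rw [essSupport_subset_iff_of_isClosed (isClosed_closedBall.inter isClosed_closure)]
  refine Filter.eventually_congr (ae_of_all _ fun y => ?_)
  rw [mem_inter_iff, and_iff_left (subset_closure y.2), mem_closedBall', not_le,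
    Subtype.dist_eq]

theorem mem_testDensities_iff [SFinite (volume : Measure Ω)] (hΩ : MeasurableSet Ω) (hε : ε ≠ 0)
    {Ψ : Lp ℝ 1 (volume : Measure (Ω × Ω))} :
    Ψ ∈ testDensities Ω ε ↔ IsTransitionDensity volume ε Ψ := by
  have hsupp : (∀ᵐ p : Ω × Ω, ε ≤ dist p.1 p.2 → Ψ p = 0) ↔
      ∀ᵐ x : Ω, essSupport (fun y : Ω => Ψ (x, y)) ⊆
        closedBall (x : EuclideanSpace ℝ (Fin N)) ε ∩ closure Ω := by
    simp_rw [essSupport_subset_closedBall_inter_closure_iff]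
    exact ae_prod_eq_zero_of_le_dist_iff (volume_sphere_subtype hΩ hε)
      (Lp.stronglyMeasurable Ψ).measurable
  exact ⟨fun h => ⟨Lp.aestronglyMeasurable Ψ, h.1, h.2.1, hsupp.2 h.2.2⟩,
    fun h => ⟨h.nonneg, h.integral_eq_one, hsupp.1 h.eq_zero⟩⟩

theorem IsTransitionDensity.exists_mem_testDensities [IsFiniteMeasure (volume : Measure Ω)]
    {Ψ : Ω × Ω → ℝ} (hΨ : IsTransitionDensity volume ε Ψ) (hΩ : MeasurableSet Ω) (hε : ε ≠ 0) :
    ∃ Φ ∈ testDensities Ω ε, Φ =ᵐ[volume] Ψ := by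
  have hint : Integrable Ψ (volume.prod volume) := by
    simpa only [mul_one] using hΨ.integrable_mul (integrable_const (1 : ℝ))
  exact ⟨hint.toL1, (mem_testDensities_iff hΩ hε).2 (hΨ.congr hint.coeFn_toL1.symm),
    hint.coeFn_toL1⟩

theorem image_transitionMean_testDensities [IsFiniteMeasure (volume : Measure Ω)]
    (hΩ : MeasurableSet Ω) (hε : ε ≠ 0) (u ρ : Ω → ℝ) :
    (fun Ψ : Lp ℝ 1 (volume : Measure (Ω × Ω)) =>
        ∫ x, (transitionMean volume Ψ u x - u x) / ε * ρ x) '' testDensities Ω ε =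
      (fun Ψ => ∫ x, (transitionMean volume Ψ u x - u x) / ε * ρ x) ''
        {Ψ | IsTransitionDensity volume ε Ψ} := by
  refine Subset.antisymm ?_ ?_
  · rintro _ ⟨Ψ, hΨ, rfl⟩
    exact ⟨Ψ, (mem_testDensities_iff hΩ hε).1 hΨ, rfl⟩
  · rintro _ ⟨Ψ, hΨ : IsTransitionDensity volume ε Ψ, rfl⟩
    obtain ⟨Φ, hΦ, hΦΨ⟩ := hΨ.exists_mem_testDensities hΩ hε
    refine ⟨Φ, hΦ, integral_congr_ae ?_⟩
    filter_upwards [transitionMean_congr_ae hΦΨ u] with x hx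
    rw [hx]

end Domain

section TotalVariation

variable {N : ℕ} {Ω : Set (EuclideanSpace ℝ (Fin N))} {ε : ℝ} {u ρ ρ₀ ρ₁ : Ω → ℝ}
  {f Ψ₀ Ψ₁ : Ω × Ω → ℝ}

theorem lowerIntegrand_eq_upperIntegrand_neg (ε : ℝ) (ρ u : Ω → ℝ) :
    lowerIntegrand ε ρ u = upperIntegrand ε ρ (-u) := by
  ext x
  rw [lowerIntegrand, upperIntegrand, essInf_eq_neg_essSup_neg, Pi.neg_apply, sub_neg_eq_add,
    sub_neg_eq_add, add_comm]

theorem integrable_upperIntegrand [(volume : Measure Ω).IsOpenPosMeasure] (hε : 0 < ε)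
    (hu : MemLp u ∞) (hρ : Integrable ρ) : Integrable (upperIntegrand ε ρ u) :=
  integrable_sub_div_mul (memLp_top_essSup_ball hε hu) hu hρ

theorem integrable_lowerIntegrand [(volume : Measure Ω).IsOpenPosMeasure] (hε : 0 < ε)
    (hu : MemLp u ∞) (hρ : Integrable ρ) : Integrable (lowerIntegrand ε ρ u) := by
  rw [lowerIntegrand_eq_upperIntegrand_neg]
  exact integrable_upperIntegrand hε hu.neg hρ

theorem pairing_ae_eq_zero_of_le_dist (h₀ : IsTransitionDensity volume ε Ψ₀)
    (h₁ : IsTransitionDensity volume ε Ψ₁) :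
    ∀ᵐ p : Ω × Ω, ε ≤ dist p.1 p.2 → pairing Ψ₀ Ψ₁ ρ₀ ρ₁ p = 0 := by
  filter_upwards [h₀.eq_zero, h₁.eq_zero] with p hp₀ hp₁ hp
  rw [pairing, hp₀ hp, hp₁ hp, zero_mul, zero_mul, sub_zero]

theorem integrable_nonlocalGrad_mul (hu : MemLp u ∞) (hf : Integrable f) :
    Integrable fun p => nonlocalGrad ε u p * f p :=
  integrable_sub_div_mul
    (memLp_top_comp_quasiMeasurePreserving hu Measure.quasiMeasurePreserving_snd)
    (memLp_top_comp_quasiMeasurePreserving hu Measure.quasiMeasurePreserving_fst) hf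

theorem integral_nonlocalGrad_mul_transitionDensity {Ψ : Ω × Ω → ℝ}
    (hΨ : IsTransitionDensity volume ε Ψ) (hu : MemLp u ∞) :
    ∫ x, ∫ y, nonlocalGrad ε u (x, y) * (Ψ (x, y) * ρ x) =
      ∫ x, (transitionMean volume Ψ u x - u x) / ε * ρ x := by
  refine integral_congr_ae ?_
  filter_upwards [hΨ.integral_eq_one, hΨ.ae_integrable_mul hu] with x hx hxu
  calc ∫ y, nonlocalGrad ε u (x, y) * (Ψ (x, y) * ρ x)
      = ∫ y, Ψ (x, y) * (u y - u x) * (ρ x / ε) := by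
        refine integral_congr_ae (ae_of_all _ fun y => ?_)
        simp only [nonlocalGrad]
        ring
    _ = (transitionMean volume Ψ u x - u x) * (ρ x / ε) := by
        rw [integral_mul_const, integral_mul_sub_const_of_integral_eq_one hx hxu, transitionMean]
    _ = (transitionMean volume Ψ u x - u x) / ε * ρ x := by ring

section Fubini

variable [SFinite (volume : Measure Ω)]

theorem nonlocalDiv_ae_eq_integral_div (hfε : ∀ᵐ p : Ω × Ω, ε ≤ dist p.1 p.2 → f p = 0) :
    nonlocalDiv ε f =ᵐ[volume] fun y => (∫ x, (f (y, x) - f (x, y))) / ε := by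
  have hswap := Measure.measurePreserving_swap.quasiMeasurePreserving.ae hfε
  filter_upwards [Measure.ae_ae_of_ae_prod hfε, Measure.ae_ae_of_ae_prod hswap] with y hy hy'
  rw [nonlocalDiv, integral_div]
  congr 1
  refine setIntegral_eq_integral_of_ae_compl_eq_zero ?_
  filter_upwards [hy, hy'] with x hx hx' hxy
  rw [mem_ball, not_lt] at hxy
  exact sub_eq_zero.2 ((hx (dist_comm x y ▸ hxy)).trans (hx' hxy).symm)

theorem integrable_nonlocalDiv (hf : Integrable f)
    (hfε : ∀ᵐ p : Ω × Ω, ε ≤ dist p.1 p.2 → f p = 0) : Integrable (nonlocalDiv ε f) :=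
  ((hf.sub hf.swap).integral_prod_left.div_const ε).congr
    (nonlocalDiv_ae_eq_integral_div hfε).symm

theorem integral_nonlocalGrad_mul_eq_neg_integral_mul_nonlocalDiv (hu : MemLp u ∞)
    (hf : Integrable f) (hfε : ∀ᵐ p : Ω × Ω, ε ≤ dist p.1 p.2 → f p = 0) :
    ∫ x, ∫ y, nonlocalGrad ε u (x, y) * f (x, y) = -∫ y, u y * nonlocalDiv ε f y :=
  calc ∫ x, ∫ y, nonlocalGrad ε u (x, y) * f (x, y)
      = (∫ x, ∫ y, (u y - u x) * f (x, y)) / ε := by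
        simp only [nonlocalGrad, div_mul_eq_mul_div, integral_div]
    _ = -∫ y, u y * ((∫ x, (f (y, x) - f (x, y))) / ε) := by
        rw [integral_sub_mul_eq_neg_integral_mul_integral_sub hu hf, neg_div, ← integral_div]
        simp only [mul_div_assoc]
    _ = -∫ y, u y * nonlocalDiv ε f y := by
        congr 1
        exact integral_congr_ae ((nonlocalDiv_ae_eq_integral_div hfε).symm.mono fun y hy =>
          congrArg (u y * ·) hy)

theorem integrable_pairing (h₀ : IsTransitionDensity volume ε Ψ₀)
    (h₁ : IsTransitionDensity volume ε Ψ₁) (hρ₀ : Integrable ρ₀) (hρ₁ : Integrable ρ₁) :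
    Integrable (pairing Ψ₀ Ψ₁ ρ₀ ρ₁) :=
  (h₀.integrable_mul hρ₀).sub (h₁.integrable_mul hρ₁)

theorem integral_nonlocalGrad_mul_pairing (hu : MemLp u ∞)
    (h₀ : IsTransitionDensity volume ε Ψ₀) (h₁ : IsTransitionDensity volume ε Ψ₁)
    (hρ₀ : Integrable ρ₀) (hρ₁ : Integrable ρ₁) :
    ∫ x, ∫ y, nonlocalGrad ε u (x, y) * pairing Ψ₀ Ψ₁ ρ₀ ρ₁ (x, y) =
      (∫ x, (transitionMean volume Ψ₀ u x - u x) / ε * ρ₀ x) +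
        ∫ x, (transitionMean volume Ψ₁ (-u) x - (-u) x) / ε * ρ₁ x := by
  have hgrad_neg : nonlocalGrad ε (-u) = -nonlocalGrad ε u := by
    ext p
    simp only [nonlocalGrad, Pi.neg_apply]
    ring
  have hint₀ := integrable_nonlocalGrad_mul (ε := ε) hu (h₀.integrable_mul hρ₀)
  have hint₁ := integrable_nonlocalGrad_mul (ε := ε) hu.neg (h₁.integrable_mul hρ₁)
  rw [← integral_nonlocalGrad_mul_transitionDensity h₀ hu,
    ← integral_nonlocalGrad_mul_transitionDensity h₁ hu.neg,
    ← integral_integral_add hint₀ hint₁, hgrad_neg]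
  simp only [pairing, Pi.neg_apply, neg_mul, sub_eq_add_neg, mul_add, mul_neg]

end Fubini

open scoped Pointwise in
theorem isLUB_integral_nonlocalGrad_mul_pairing [IsFiniteMeasure (volume : Measure Ω)]
    [(volume : Measure Ω).IsOpenPosMeasure] (hΩ : MeasurableSet Ω) (hε : 0 < ε)
    (hum : Measurable u) (hu : MemLp u ∞) (hρ₀ : Integrable ρ₀) (hρ₁ : Integrable ρ₁)
    (hρ₀0 : 0 ≤ᵐ[volume] ρ₀) (hρ₁0 : 0 ≤ᵐ[volume] ρ₁) :
    IsLUB {r : ℝ | ∃ Ψ₀ ∈ testDensities Ω ε, ∃ Ψ₁ ∈ testDensities Ω ε,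
        r = ∫ x : Ω, ∫ y : Ω, nonlocalGrad ε u (x, y) * pairing Ψ₀ Ψ₁ ρ₀ ρ₁ (x, y)}
      (adversarialTV ε ρ₀ ρ₁ u) := by
  rw [adversarialTV, lowerIntegrand_eq_upperIntegrand_neg]
  have hsum : {r : ℝ | ∃ Ψ₀ ∈ testDensities Ω ε, ∃ Ψ₁ ∈ testDensities Ω ε,
        r = ∫ x : Ω, ∫ y : Ω, nonlocalGrad ε u (x, y) * pairing Ψ₀ Ψ₁ ρ₀ ρ₁ (x, y)} =
      (fun Ψ : Lp ℝ 1 (volume : Measure (Ω × Ω)) =>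
          ∫ x, (transitionMean volume Ψ u x - u x) / ε * ρ₀ x) '' testDensities Ω ε +
        (fun Ψ : Lp ℝ 1 (volume : Measure (Ω × Ω)) =>
          ∫ x, (transitionMean volume Ψ (-u) x - (-u) x) / ε * ρ₁ x) '' testDensities Ω ε := by
    ext r
    simp only [mem_ofPred_eq, mem_add, exists_mem_image]
    refine exists_congr fun Ψ₀ => and_congr_right fun h₀ => exists_congr fun Ψ₁ =>
      and_congr_right fun h₁ => ?_
    rw [mem_testDensities_iff hΩ hε.ne'] at h₀ h₁
    rw [integral_nonlocalGrad_mul_pairing hu h₀ h₁ hρ₀ hρ₁, eq_comm]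
  rw [hsum, image_transitionMean_testDensities hΩ hε.ne',
    image_transitionMean_testDensities hΩ hε.ne']
  exact (isLUB_integral_transitionMean_sub hε hum hu hρ₀ hρ₀0).add
    (isLUB_integral_transitionMean_sub hε hum.neg hu.neg hρ₁ hρ₁0)

theorem integrable_density (μ : Measure (Ω × Fin 2)) [IsFiniteMeasure μ] (i : Fin 2) :
    Integrable (density μ i) := by
  have : IsFiniteMeasure (classMeasure μ i) := by
    unfold classMeasure
    infer_instance
  exact Measure.integrable_toReal_rnDeriv

theorem density_nonneg (μ : Measure (Ω × Fin 2)) (i : Fin 2) (x : Ω) : 0 ≤ density μ i x :=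
  ENNReal.toReal_nonneg

end TotalVariation

end AdversarialTV

open AdversarialTV in
theorem mainTheorem4_general {N : ℕ} {Ω : Set (EuclideanSpace ℝ (Fin N))} (hΩo : IsOpen Ω)
    (hΩfin : volume Ω ≠ ∞) {ε : ℝ} (hε : 0 < ε) {ρ₀ ρ₁ : Ω → ℝ} (hρ₀ : Integrable ρ₀)
    (hρ₁ : Integrable ρ₁) (hρ₀0 : 0 ≤ᵐ[volume] ρ₀) (hρ₁0 : 0 ≤ᵐ[volume] ρ₁)
    (u : Lp ℝ ∞ (volume : Measure Ω)) :
    (Integrable (upperIntegrand ε ρ₀ u) ∧ Integrable (lowerIntegrand ε ρ₁ u)) ∧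
    (∀ Ψ₀ ∈ testDensities Ω ε, ∀ Ψ₁ ∈ testDensities Ω ε,
      Integrable (pairing Ψ₀ Ψ₁ ρ₀ ρ₁) ∧
      Integrable (fun p : Ω × Ω => nonlocalGrad ε u p * pairing Ψ₀ Ψ₁ ρ₀ ρ₁ p) ∧
      Integrable (nonlocalDiv ε (pairing Ψ₀ Ψ₁ ρ₀ ρ₁)) ∧
      Integrable (fun y : Ω => u y * nonlocalDiv ε (pairing Ψ₀ Ψ₁ ρ₀ ρ₁) y)) ∧
    IsLUB {r : ℝ | ∃ Ψ₀ ∈ testDensities Ω ε, ∃ Ψ₁ ∈ testDensities Ω ε,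
        r = ∫ x : Ω, ∫ y : Ω, nonlocalGrad ε u (x, y) * pairing Ψ₀ Ψ₁ ρ₀ ρ₁ (x, y)}
      (adversarialTV ε ρ₀ ρ₁ u) ∧
    IsLUB {r : ℝ | ∃ Ψ₀ ∈ testDensities Ω ε, ∃ Ψ₁ ∈ testDensities Ω ε,
        r = -∫ y : Ω, u y * nonlocalDiv ε (pairing Ψ₀ Ψ₁ ρ₀ ρ₁) y}
      (adversarialTV ε ρ₀ ρ₁ u) := by
  have hΩ := hΩo.measurableSet
  have := isFiniteMeasure_volume_subtype hΩ hΩfin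
  have := isOpenPosMeasure_volume_subtype hΩo
  have hu : MemLp u ∞ := Lp.memLp u
  have hgrad := isLUB_integral_nonlocalGrad_mul_pairing hΩ hε
    (Lp.stronglyMeasurable u).measurable hu hρ₀ hρ₁ hρ₀0 hρ₁0
  refine ⟨⟨integrable_upperIntegrand hε hu hρ₀, integrable_lowerIntegrand hε hu hρ₁⟩,
    fun Ψ₀ h₀ Ψ₁ h₁ => ?_, hgrad, ?_⟩
  · rw [mem_testDensities_iff hΩ hε.ne'] at h₀ h₁
    have hint := integrable_pairing h₀ h₁ hρ₀ hρ₁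
    have hdiv := integrable_nonlocalDiv hint (pairing_ae_eq_zero_of_le_dist h₀ h₁)
    exact ⟨hint, integrable_nonlocalGrad_mul hu hint, hdiv, hdiv.mul_of_top_right hu⟩
  · convert hgrad using 1
    ext r
    refine exists_congr fun Ψ₀ => and_congr_right fun h₀ => exists_congr fun Ψ₁ =>
      and_congr_right fun h₁ => ?_
    rw [mem_testDensities_iff hΩ hε.ne'] at h₀ h₁
    rw [integral_nonlocalGrad_mul_eq_neg_integral_mul_nonlocalDiv hu
      (integrable_pairing h₀ h₁ hρ₀ hρ₁) (pairing_ae_eq_zero_of_le_dist h₀ h₁)]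

theorem mainTheorem4 {N : ℕ} (Ω : Set (EuclideanSpace ℝ (Fin N)))
    (hΩo : IsOpen Ω) (hΩb : Bornology.IsBounded Ω) (hΩc : Convex ℝ Ω)
    (ε : ℝ) (hε : 0 < ε)
    (μ : Measure (Ω × Fin 2)) [IsProbabilityMeasure μ]
    (hρ : ∀ i : Fin 2, AdversarialTV.classMeasure μ i ≪ (volume : Measure Ω))
    (ρ₀ ρ₁ : Ω → ℝ)
    (hρ₀ : ρ₀ = AdversarialTV.density μ 0) (hρ₁ : ρ₁ = AdversarialTV.density μ 1)
    (u : Lp ℝ ∞ (volume : Measure Ω)) :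
    -- all integrals below exist, and the nonlocal divergence is in `L¹(Ω)`
    (Integrable (AdversarialTV.upperIntegrand ε ρ₀ u) ∧
      Integrable (AdversarialTV.lowerIntegrand ε ρ₁ u)) ∧
    (∀ Ψ₀ ∈ AdversarialTV.testDensities Ω ε, ∀ Ψ₁ ∈ AdversarialTV.testDensities Ω ε,
      Integrable (AdversarialTV.pairing Ψ₀ Ψ₁ ρ₀ ρ₁) ∧
      Integrable (fun p : Ω × Ω =>
        AdversarialTV.nonlocalGrad ε u p * AdversarialTV.pairing Ψ₀ Ψ₁ ρ₀ ρ₁ p) ∧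
      Integrable (AdversarialTV.nonlocalDiv ε (AdversarialTV.pairing Ψ₀ Ψ₁ ρ₀ ρ₁)) ∧
      Integrable (fun y : Ω =>
        u y * AdversarialTV.nonlocalDiv ε (AdversarialTV.pairing Ψ₀ Ψ₁ ρ₀ ρ₁) y)) ∧
    -- the first representation
    IsLUB {r : ℝ | ∃ Ψ₀ ∈ AdversarialTV.testDensities Ω ε,
        ∃ Ψ₁ ∈ AdversarialTV.testDensities Ω ε,
        r = ∫ x : Ω, ∫ y : Ω, AdversarialTV.nonlocalGrad ε u (x, y) *
          AdversarialTV.pairing Ψ₀ Ψ₁ ρ₀ ρ₁ (x, y)}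
      (AdversarialTV.adversarialTV ε ρ₀ ρ₁ u) ∧
    -- the second representation
    IsLUB {r : ℝ | ∃ Ψ₀ ∈ AdversarialTV.testDensities Ω ε,
        ∃ Ψ₁ ∈ AdversarialTV.testDensities Ω ε,
        r = -∫ y : Ω, u y *
          AdversarialTV.nonlocalDiv ε (AdversarialTV.pairing Ψ₀ Ψ₁ ρ₀ ρ₁) y}
      (AdversarialTV.adversarialTV ε ρ₀ ρ₁ u) := by
  subst hρ₀ hρ₁
  exact mainTheorem4_general hΩo hΩb.measure_lt_top.ne hε (AdversarialTV.integrable_density μ 0)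
    (AdversarialTV.integrable_density μ 1) (ae_of_all _ (AdversarialTV.density_nonneg μ 0))
    (ae_of_all _ (AdversarialTV.density_nonneg μ 1)) u
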